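/- Let $N\ge 1$ be an integer and let $$\hat J_N=\max\Big\{\sum_{j=1}^N\alpha_j \;:\; \alpha_1,\dots,\alpha_N\in\mathbb R,\ \alpha_1=1,\ \sum_{j=1}^N\alpha_j\sin jt\ge 0 \text{ for all } t\in[0,\pi]\Big\}.$$ The maximum is attained. If $N$ is odd, then $$\hat J_N=\tfrac14\csc^2\frac{\pi}{2(N+2)}.$$ If $N$ is even, then the equation $$(N+3)\cos\big((N+1)\vartheta\big)+(N+1)\cos\big((N+3)\vartheta\big)=0$$ has a least positive root $\vartheta$, and $$\hat J_N=\tfrac14\csc^2\vartheta.$$ -/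

import Mathlib

/-- The sine polynomial `t ↦ ∑_{j=1}^N α_j sin (j t)`; only `α 1, …, α N` matter. -/
noncomputable def sinePoly (N : ℕ) (α : ℕ → ℝ) (t : ℝ) : ℝ :=
  ∑ j ∈ Finset.Icc 1 N, α j * Real.sin ((j : ℝ) * t)

/-- The values `∑_{j=1}^N α_j` taken by the objective over all real coefficient sequences with
`α_1 = 1` whose sine polynomial is nonnegative on `[0, π]`. -/
def auxValues (N : ℕ) : Set ℝ :=
  {s | ∃ α : ℕ → ℝ, α 1 = 1 ∧ (∀ t ∈ Set.Icc (0 : ℝ) Real.pi, 0 ≤ sinePoly N α t) ∧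
    s = ∑ j ∈ Finset.Icc 1 N, α j}

/-- The positive real roots of `(N+3) cos ((N+1) θ) + (N+1) cos ((N+3) θ) = 0`. -/
def posRoots (N : ℕ) : Set ℝ :=
  {θ | 0 < θ ∧ ((N : ℝ) + 3) * Real.cos (((N : ℝ) + 1) * θ)
      + ((N : ℝ) + 1) * Real.cos (((N : ℝ) + 3) * θ) = 0}

/-! Write the sine polynomial as `sin t * P (cos t)` with `deg P < N`; admissibility becomes `P ≥ 0`
on `[-1, 1]`. For `L = weightedMean` one has `L P = ∑ α_j` and `L ((1 - X) P) = α_1 / 2`, so `L P`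
is to be maximized subject to `L ((1 - X) P) = 1/2`.

Suppose a quadrature rule for `L`, exact up to degree `N`, has nonnegative weights, nodes in `[-1,
1]` and largest node `x < 1`. Then `L ((x - X) P) ≥ 0`, that is, `L P ≤ 1 / (2 (1 - x))`, with
equality if `P` vanishes at the other nodes (`isGreatest_auxValues_of_nodes`).

The orthogonal polynomials of `L` are the `chebyshevV k` (`weightedMean_chebyshevV_mul`). Odd `N`
uses their Gauss rule; even `N` uses the Gauss–Radau rule with a node at `-1`, whose other nodes
`cos 2φ` come from the cosine equation. For `x = cos 2θ` the bound is `csc² θ / 4`. -/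

open Polynomial
open Polynomial.Chebyshev hiding C C_mul

/-! ### Orthogonality of Chebyshev polynomials. -/

/-- The functional `P ↦ ∫₀^π P (cos t) dt` on polynomials. -/
noncomputable def integralCos : ℝ[X] →ₗ[ℝ] ℝ where
  toFun P := ∫ t in (0 : ℝ)..Real.pi, P.eval (Real.cos t)
  map_add' P Q := by
    simp only [eval_add]
    exact intervalIntegral.integral_add
      (Continuous.intervalIntegrable (by fun_prop) _ _)
      (Continuous.intervalIntegrable (by fun_prop) _ _)
  map_smul' c P := by simp

theorem integralCos_apply (P : ℝ[X]) :
    integralCos P = ∫ t in (0 : ℝ)..Real.pi, P.eval (Real.cos t) := rfl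

theorem integralCos_T {k : ℤ} (hk : k ≠ 0) : integralCos (T ℝ k) = 0 := by
  rw [integralCos_apply, ← integral_measureT_eq_integral_cos (f := fun x => (T ℝ k).eval x),
    integral_eval_T_real_measureT_of_ne_zero hk]

theorem integralCos_T_mul_X_pow (j : ℕ) :
    ∀ k : ℤ, (j : ℤ) < k → integralCos (T ℝ k * X ^ j) = 0 := by
  induction j with
  | zero => intro k hk; simpa using integralCos_T (by grind)
  | succ j ih =>
    intro k hk
    -- One power of `X` is traded for an index shift by one, which preserves the gap `j < k`.
    have h : T ℝ k * X ^ (j + 1)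
        = (1 / 2 : ℝ) • (T ℝ (k + 1) * X ^ j + T ℝ (k - 1) * X ^ j) := by
      rw [T_sub_one, ← add_mul, add_sub_cancel, smul_eq_C_mul,
        show (2 : ℝ[X]) = C 2 from rfl]
      have : C (1 / 2 : ℝ) * C 2 = 1 := by rw [← C_mul]; norm_num
      linear_combination (-(X * T ℝ k * X ^ j)) * this
    rw [h, map_smul, map_add, ih _ (by push_cast at hk; omega), ih _ (by push_cast at hk; omega)]
    simp

theorem integralCos_T_mul {k : ℕ} {r : ℝ[X]} (hr : r.degree < k) :
    integralCos (T ℝ k * r) = 0 := by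
  rcases eq_or_ne r 0 with rfl | h0
  · simp
  rw [degree_eq_natDegree h0] at hr
  rw [r.as_sum_range_C_mul_X_pow, Finset.mul_sum, map_sum]
  refine Finset.sum_eq_zero fun j hj => ?_
  rw [mul_left_comm, ← smul_eq_C_mul, map_smul, integralCos_T_mul_X_pow, smul_zero]
  have := Finset.mem_range.mp hj
  have : r.natDegree < k := by exact_mod_cast hr
  omega

/-- The functional `P ↦ π⁻¹ ∫₀^π P (cos t) (1 + cos t) dt` on polynomials. -/
noncomputable def weightedMean : ℝ[X] →ₗ[ℝ] ℝ :=
  Real.pi⁻¹ • integralCos ∘ₗ LinearMap.mulLeft ℝ (1 + X)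

theorem weightedMean_apply (P : ℝ[X]) :
    weightedMean P = Real.pi⁻¹ * integralCos ((1 + X) * P) := rfl

theorem weightedMean_nonneg {P : ℝ[X]} (hP : ∀ x ∈ Set.Icc (-1 : ℝ) 1, 0 ≤ P.eval x) :
    0 ≤ weightedMean P := by
  rw [weightedMean_apply, integralCos_apply]
  refine mul_nonneg (by positivity) (intervalIntegral.integral_nonneg Real.pi_nonneg fun t _ => ?_)
  simp only [eval_mul, eval_add, eval_one, eval_X]
  exact mul_nonneg (by linarith [Real.neg_one_le_cos t]) (hP _ (Real.cos_mem_Icc t))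

/-- The point `-1` is excluded because the weight `1 + X` vanishes there. -/
theorem weightedMean_pos {P : ℝ[X]} (hP : ∀ x ∈ Set.Icc (-1 : ℝ) 1, 0 ≤ P.eval x) {x : ℝ}
    (hx : x ∈ Set.Ioc (-1 : ℝ) 1) (hPx : 0 < P.eval x) : 0 < weightedMean P := by
  rw [weightedMean_apply, integralCos_apply]
  refine mul_pos (by positivity) (intervalIntegral.integral_pos Real.pi_pos
    (Continuous.continuousOn (by fun_prop)) (fun t _ => ?_)
    ⟨Real.arccos x, ⟨Real.arccos_nonneg x, Real.arccos_le_pi x⟩, ?_⟩)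
  · simp only [eval_mul, eval_add, eval_one, eval_X]
    exact mul_nonneg (by linarith [Real.neg_one_le_cos t]) (hP _ (Real.cos_mem_Icc t))
  · simp only [eval_mul, eval_add, eval_one, eval_X]
    rw [Real.cos_arccos hx.1.le hx.2]
    exact mul_pos (by linarith [hx.1]) hPx

/-- The Chebyshev polynomials of the third kind. -/
noncomputable def chebyshevV (k : ℕ) : ℝ[X] := U ℝ k - U ℝ (k - 1)

theorem one_add_X_mul_chebyshevV (k : ℕ) :
    (1 + X) * chebyshevV k = T ℝ (k + 1 : ℕ) + T ℝ k := by
  have h1 := T_eq_U_sub_X_mul_U ℝ k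
  have h2 := T_eq_U_sub_X_mul_U ℝ (k + 1)
  have h3 := U_add_one ℝ k
  rw [add_sub_cancel_right] at h2
  push_cast
  rw [chebyshevV, h1, h2, h3]
  ring

theorem weightedMean_chebyshevV_mul {k : ℕ} {r : ℝ[X]} (hr : r.degree < k) :
    weightedMean (chebyshevV k * r) = 0 := by
  rw [weightedMean_apply, ← mul_assoc, one_add_X_mul_chebyshevV, add_mul, map_add,
    integralCos_T_mul hr, integralCos_T_mul (hr.trans (by exact_mod_cast k.lt_succ_self))]
  simp

/-- Consecutive `U`'s differ by some `chebyshevV (k + 1)`, which is orthogonal to constants. -/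
theorem weightedMean_U (k : ℕ) : weightedMean (U ℝ k) = 1 := by
  induction k with
  | zero =>
    have : integralCos X = 0 := by simpa using integralCos_T (k := 1) one_ne_zero
    have h1 : integralCos 1 = Real.pi := by simp [integralCos_apply]
    simp [weightedMean_apply, this, h1, Real.pi_ne_zero]
  | succ k ih =>
    have h := weightedMean_chebyshevV_mul (k := k + 1) (r := 1) (by simp; exact_mod_cast k.succ_pos)
    rw [mul_one, chebyshevV, map_sub] at h
    push_cast at h ⊢
    rw [add_sub_cancel_right, ih] at h
    linarith

/-- By `2 X U_k = U_{k+1} + U_{k-1}` the means cancel, except for `k = 0`, where `U_{-1} = 0`. -/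
theorem weightedMean_one_sub_X_mul_U (k : ℕ) :
    weightedMean ((1 - X) * U ℝ k) = if k = 0 then 1 / 2 else 0 := by
  have h : (1 - X) * U ℝ k
      = U ℝ k - (1 / 2 : ℝ) • (U ℝ (k + 1 : ℕ) + U ℝ (k - 1)) := by
    push_cast
    rw [U_add_one, sub_add_cancel, smul_eq_C_mul, show (2 : ℝ[X]) = C 2 from rfl]
    have : C (1 / 2 : ℝ) * C 2 = 1 := by rw [← C_mul]; norm_num
    linear_combination (X * U ℝ k) * this
  rw [h, map_sub, map_smul, map_add, weightedMean_U, weightedMean_U]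
  rcases k with _ | k
  · simp; norm_num
  · have : U ℝ (((k + 1 : ℕ) : ℤ) - 1) = U ℝ k := by push_cast; rw [add_sub_cancel_right]
    rw [this, weightedMean_U]; norm_num

/-- Every polynomial of degree below `n` is a combination of `U_0, …, U_{n-1}`. -/
theorem exists_eq_sum_U (n : ℕ) : ∀ P : ℝ[X], P.degree < n →
    ∃ a : ℕ → ℝ, P = ∑ j ∈ Finset.range n, C (a j) * U ℝ j := by
  induction n with
  | zero => intro P hP; exact ⟨0, by simpa using hP⟩
  | succ n ih =>
    intro P hP
    have hc : (U ℝ n).coeff n = 2 ^ n := by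
      have := leadingCoeff_U_natCast (R := ℝ) n
      rwa [leadingCoeff, natDegree_U_natCast] at this
    set c := P.coeff n / 2 ^ n with hcdef
    obtain ⟨a, ha⟩ := ih (P - C c * U ℝ n) (by
      rw [degree_lt_iff_coeff_zero] at hP ⊢
      intro m hm
      rcases hm.eq_or_lt with rfl | hm
      · simp [hc, hcdef]
      · rw [coeff_sub, hP m hm, coeff_C_mul,
          coeff_eq_zero_of_natDegree_lt (by rwa [natDegree_U_natCast])]
        simp)
    refine ⟨fun j => if j = n then c else a j, ?_⟩
    simp only [Finset.sum_range_succ, if_true]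
    rw [← sub_eq_iff_eq_add, ha]
    refine Finset.sum_congr rfl fun j hj => ?_
    rw [if_neg (Finset.mem_range.mp hj).ne]

/-! ### From sine polynomials to algebraic polynomials. -/

/-- The algebraic polynomial attached to a sine polynomial. -/
noncomputable def sinePolyQuot (N : ℕ) (α : ℕ → ℝ) : ℝ[X] :=
  ∑ j ∈ Finset.range N, C (α (j + 1)) * U ℝ j

theorem sum_Icc_one_eq_sum_range (N : ℕ) (f : ℕ → ℝ) :
    ∑ j ∈ Finset.Icc 1 N, f j = ∑ j ∈ Finset.range N, f (j + 1) := by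
  rw [Finset.range_eq_Ico, Finset.sum_Ico_add' f 0 N 1]
  rfl

theorem sinePoly_eq (N : ℕ) (α : ℕ → ℝ) (t : ℝ) :
    sinePoly N α t = (sinePolyQuot N α).eval (Real.cos t) * Real.sin t := by
  rw [sinePoly, sum_Icc_one_eq_sum_range, sinePolyQuot, eval_finsetSum, Finset.sum_mul]
  refine Finset.sum_congr rfl fun j _ => ?_
  rw [eval_mul, eval_C, mul_assoc, U_real_cos]
  push_cast
  rfl

theorem degree_sinePolyQuot_lt (N : ℕ) (α : ℕ → ℝ) : (sinePolyQuot N α).degree < N := by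
  rw [← mem_degreeLT]
  refine Submodule.sum_mem _ fun j hj => ?_
  rw [← smul_eq_C_mul]
  refine Submodule.smul_mem _ _ ?_
  rw [mem_degreeLT, degree_U_natCast]
  exact_mod_cast Finset.mem_range.mp hj

theorem weightedMean_sinePolyQuot (N : ℕ) (α : ℕ → ℝ) :
    weightedMean (sinePolyQuot N α) = ∑ j ∈ Finset.Icc 1 N, α j := by
  rw [sum_Icc_one_eq_sum_range, sinePolyQuot, map_sum]
  refine Finset.sum_congr rfl fun j _ => ?_
  rw [← smul_eq_C_mul, map_smul, weightedMean_U, smul_eq_mul, mul_one]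

theorem weightedMean_one_sub_X_mul_sinePolyQuot {N : ℕ} (hN : 1 ≤ N) (α : ℕ → ℝ) :
    weightedMean ((1 - X) * sinePolyQuot N α) = α 1 / 2 := by
  rw [sinePolyQuot, Finset.mul_sum, map_sum, Finset.sum_eq_single 0]
  · rw [mul_left_comm, ← smul_eq_C_mul, map_smul, weightedMean_one_sub_X_mul_U]
    simp [div_eq_mul_inv]
  · intro j _ hj
    rw [mul_left_comm, ← smul_eq_C_mul, map_smul, weightedMean_one_sub_X_mul_U, if_neg hj,
      smul_zero]
  · intro h; exact absurd (Finset.mem_range.mpr hN) h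

theorem sinePolyQuot_nonneg {N : ℕ} {α : ℕ → ℝ}
    (h : ∀ t ∈ Set.Icc (0 : ℝ) Real.pi, 0 ≤ sinePoly N α t) :
    ∀ x ∈ Set.Icc (-1 : ℝ) 1, 0 ≤ (sinePolyQuot N α).eval x := by
  have hopen : ∀ x ∈ Set.Ioo (-1 : ℝ) 1, 0 ≤ (sinePolyQuot N α).eval x := by
    intro x hx
    have h0 := h (Real.arccos x) ⟨Real.arccos_nonneg x, Real.arccos_le_pi x⟩
    rw [sinePoly_eq, Real.cos_arccos hx.1.le hx.2.le] at h0
    refine nonneg_of_mul_nonneg_left h0 (Real.sin_pos_of_pos_of_lt_pi ?_ ?_)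
    · exact Real.arccos_pos.mpr hx.2
    · refine (Real.arccos_le_pi x).lt_of_ne fun h => ?_
      rw [Real.arccos_eq_pi] at h
      linarith [hx.1]
  -- The sine vanishes at both endpoints, so these are reached by continuity.
  rw [← closure_Ioo (by norm_num : (-1 : ℝ) ≠ 1)]
  exact closure_minimal hopen (isClosed_le continuous_const (sinePolyQuot N α).continuous)

/-! ### Quadrature and the extremal principle. -/

/-- A functional that annihilates `nodal Z * r` for `deg r < d` is given by the quadrature rule
with nodes `Z` on polynomials of degree below `#Z + d`. -/
theorem quadrature (L : ℝ[X] →ₗ[ℝ] ℝ) {Z : Finset ℝ} {d : ℕ}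
    (hL : ∀ r : ℝ[X], r.degree < d → L (Lagrange.nodal Z id * r) = 0)
    {F : ℝ[X]} (hF : F.degree < (Z.card + d : ℕ)) :
    L F = ∑ z ∈ Z, F.eval z * L (Lagrange.basis Z id z) := by
  have hmon : (Lagrange.nodal Z id : ℝ[X]).Monic := Lagrange.nodal_monic
  have hquot : (F /ₘ Lagrange.nodal Z id).degree < d := by
    rcases lt_or_ge F.degree (Lagrange.nodal Z (id : ℝ → ℝ)).degree with h | h
    · rw [(divByMonic_eq_zero_iff hmon).mpr h]
      simp
    · have := degree_add_divByMonic hmon h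
      rw [← this, Lagrange.degree_nodal, Nat.cast_add] at hF
      exact lt_of_add_lt_add_left hF
  have hrem : F %ₘ Lagrange.nodal Z id = Lagrange.interpolate Z id fun z => F.eval z := by
    refine Lagrange.eq_interpolate_of_eval_eq _ (Set.injOn_id _) ?_ fun z hz => ?_
    · simpa using degree_modByMonic_lt F hmon
    · have h := congrArg (eval z) (modByMonic_add_div F (Lagrange.nodal Z id))
      have h0 : eval z (Lagrange.nodal Z id) = 0 := Lagrange.eval_nodal_at_node (v := id) hz
      rw [eval_add, eval_mul, h0, zero_mul, add_zero] at h
      exact h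
  conv_lhs => rw [← modByMonic_add_div F (Lagrange.nodal Z id), map_add, hL _ hquot, add_zero,
    hrem, Lagrange.interpolate_apply, map_sum]
  refine Finset.sum_congr rfl fun z _ => ?_
  rw [← smul_eq_C_mul, map_smul, smul_eq_mul]

/-- The square of a Lagrange basis polynomial isolates its weight; its degree `2 (#Z - 1)` is within
the range of exactness because `#Z ≤ d + 1`. -/
theorem quadrature_weight_nonneg (L : ℝ[X] →ₗ[ℝ] ℝ) {Z : Finset ℝ} {d : ℕ}
    (hL : ∀ r : ℝ[X], r.degree < d → L (Lagrange.nodal Z id * r) = 0)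
    (hsq : ∀ Q : ℝ[X], 0 ≤ L (Q ^ 2)) (hcard : Z.card ≤ d + 1) {z : ℝ} (hz : z ∈ Z) :
    0 ≤ L (Lagrange.basis Z id z) := by
  have hpos := Finset.card_pos.mpr ⟨z, hz⟩
  have h := quadrature L hL (F := Lagrange.basis Z id z ^ 2) (by
    rw [degree_pow, Lagrange.degree_basis (Set.injOn_id _) hz, nsmul_eq_mul]
    norm_cast
    omega)
  rw [Finset.sum_eq_single z, eval_pow,
    show eval z (Lagrange.basis Z id z) = 1 from Lagrange.eval_basis_self (Set.injOn_id _) hz,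
    one_pow, one_mul] at h
  · exact h ▸ hsq _
  · intro y hy hyz
    rw [eval_pow, show eval y (Lagrange.basis Z id z) = 0 from
      Lagrange.eval_basis_of_ne (v := id) hyz.symm hy]
    simp
  · exact fun h => absurd hz h

/-- With as many roots as its degree, `R` is a scalar multiple of the nodal polynomial. -/
theorem annihilates_nodal (L : ℝ[X] →ₗ[ℝ] ℝ) {Z : Finset ℝ} {d : ℕ} {R : ℝ[X]}
    (hdeg : R.degree = Z.card) (hroot : ∀ z ∈ Z, R.eval z = 0)
    (hL : ∀ r : ℝ[X], r.degree < d → L (R * r) = 0) (r : ℝ[X]) (hr : r.degree < d) :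
    L (Lagrange.nodal Z id * r) = 0 := by
  have hR : R ≠ 0 := by rintro rfl; simp at hdeg
  have hlc : R.leadingCoeff ≠ 0 := leadingCoeff_ne_zero.mpr hR
  have h : R = C R.leadingCoeff * Lagrange.nodal Z id := by
    refine Polynomial.eq_of_degree_le_of_eval_finset_eq Z hdeg.le ?_ ?_ fun z hz => ?_
    · rw [degree_C_mul hlc, Lagrange.degree_nodal, hdeg]
    · rw [leadingCoeff_mul, leadingCoeff_C, (Lagrange.nodal_monic : Monic _).leadingCoeff, mul_one]
    · rw [hroot z hz, eval_mul,
        show eval z (Lagrange.nodal Z id) = 0 from Lagrange.eval_nodal_at_node (v := id) hz,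
        mul_zero]
  have h0 := hL r hr
  rw [h, mul_assoc, ← smul_eq_C_mul, map_smul, smul_eq_mul] at h0
  exact (mul_eq_zero.mp h0).resolve_left hlc

/-- The extremal value is determined by the largest node of a quadrature rule with nonnegative
weights, as soon as some admissible polynomial vanishes at all other nodes. -/
theorem isGreatest_auxValues_of_nodes {N d : ℕ} (hN : 1 ≤ N) {Z : Finset ℝ} {x : ℝ}
    (hxZ : x ∈ Z) (hmax : ∀ z ∈ Z, z ≤ x) (hZ : ∀ z ∈ Z, -1 ≤ z) (hx : x ∈ Set.Ioo (-1 : ℝ) 1)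
    (hL : ∀ r : ℝ[X], r.degree < d → weightedMean (Lagrange.nodal Z id * r) = 0)
    (hcard : Z.card ≤ d + 1) (hNd : N + 1 ≤ Z.card + d)
    {P : ℝ[X]} (hPdeg : P.degree < N) (hPnonneg : ∀ y ∈ Set.Icc (-1 : ℝ) 1, 0 ≤ P.eval y)
    (hPzero : ∀ z ∈ Z, z ≠ x → P.eval z = 0) (hPx : 0 < P.eval x) :
    IsGreatest (auxValues N) (1 / (2 * (1 - x))) := by
  have hx1 : 0 < 1 - x := by linarith [hx.2]
  have hdeg : ∀ Q : ℝ[X], Q.degree < N → ((C x - X) * Q).degree < ((Z.card + d : ℕ) : WithBot ℕ) := by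
    intro Q hQ
    have h1 : ((C x - X) * Q).degree ≤ 1 + Q.degree :=
      (degree_mul_le _ _).trans (by gcongr; rw [← neg_sub, degree_neg]; exact degree_X_sub_C_le x)
    have h2 : 1 + Q.degree < ((N + 1 : ℕ) : WithBot ℕ) := by
      rcases eq_or_ne Q 0 with rfl | h0
      · simp
      rw [degree_eq_natDegree h0] at hQ ⊢
      norm_cast at hQ ⊢
      omega
    exact (h1.trans_lt h2).trans_le (by exact_mod_cast hNd)
  have hsplit : ∀ Q : ℝ[X], weightedMean ((C x - X) * Q)
      = weightedMean ((1 - X) * Q) - (1 - x) * weightedMean Q := by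
    intro Q
    rw [← smul_eq_mul (1 - x), ← map_smul, ← map_sub, smul_eq_C_mul, C_sub, C_1]
    congr 1
    ring
  constructor
  · have hL0 : weightedMean ((C x - X) * P) = 0 := by
      rw [quadrature weightedMean hL (hdeg P hPdeg)]
      refine Finset.sum_eq_zero fun z hz => ?_
      rcases eq_or_ne z x with rfl | hzx
      · simp
      · simp [hPzero z hz hzx]
    have hPpos : 0 < weightedMean P := weightedMean_pos hPnonneg ⟨hx.1, hx.2.le⟩ hPx
    rw [hsplit] at hL0
    obtain ⟨a, ha⟩ := exists_eq_sum_U N P hPdeg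
    -- Index shift: `a j` multiplies `U_j`, which corresponds to `sin ((j + 1) t)`.
    have hquot : sinePolyQuot N (fun j => a (j - 1)) = P := by
      rw [ha, sinePolyQuot]; simp
    have ha0 : a 0 = 2 * ((1 - x) * weightedMean P) := by
      have := weightedMean_one_sub_X_mul_sinePolyQuot hN (fun j => a (j - 1))
      rw [hquot] at this
      simp only [Nat.sub_self] at this
      linarith
    have ha0pos : 0 < a 0 := by rw [ha0]; positivity
    refine ⟨fun j => (a 0)⁻¹ * a (j - 1), by simp [ha0pos.ne'], fun t ht => ?_, ?_⟩
    · have : sinePoly N (fun j => (a 0)⁻¹ * a (j - 1)) t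
          = (a 0)⁻¹ * sinePoly N (fun j => a (j - 1)) t := by
        simp only [sinePoly, Finset.mul_sum, mul_assoc]
      rw [this, sinePoly_eq, hquot]
      exact mul_nonneg (by positivity) (mul_nonneg (hPnonneg _ (Real.cos_mem_Icc t))
        (Real.sin_nonneg_of_mem_Icc ht))
    · rw [← Finset.mul_sum, ← weightedMean_sinePolyQuot N (fun j => a (j - 1)), hquot, ha0]
      field_simp
  · rintro s ⟨α, hα1, hα, rfl⟩
    have hnn := sinePolyQuot_nonneg hα
    have hL0 : 0 ≤ weightedMean ((C x - X) * sinePolyQuot N α) := by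
      rw [quadrature weightedMean hL (hdeg _ (degree_sinePolyQuot_lt N α))]
      refine Finset.sum_nonneg fun z hz => mul_nonneg ?_
        (quadrature_weight_nonneg weightedMean hL
          (fun Q => weightedMean_nonneg fun y _ => by rw [eval_pow]; positivity) hcard hz)
      rw [eval_mul, eval_sub, eval_C, eval_X]
      exact mul_nonneg (by linarith [hmax z hz])
        (hnn z ⟨hZ z hz, (hmax z hz).trans hx.2.le⟩)
    rw [hsplit, weightedMean_one_sub_X_mul_sinePolyQuot hN, hα1, weightedMean_sinePolyQuot] at hL0
    rw [le_div_iff₀ (by positivity)]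
    linarith

/-! ### Odd `N`: the Gauss rule. -/

theorem one_div_two_mul_one_sub_cos (θ : ℝ) :
    1 / (2 * (1 - Real.cos (2 * θ))) = 1 / 4 * (1 / Real.sin θ) ^ 2 := by
  rw [Real.cos_two_mul, Real.cos_sq', div_pow, one_pow, div_mul_div_comm, one_mul]
  congr 1
  ring

theorem degree_chebyshevV (k : ℕ) : (chebyshevV k).degree = k := by
  rw [chebyshevV, degree_sub_eq_left_of_degree_lt] <;> rw [degree_U_natCast]
  rcases k with _ | k
  · simp
  · rw [show ((k + 1 : ℕ) : ℤ) - 1 = k by push_cast; ring, degree_U_natCast]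
    exact_mod_cast k.lt_succ_self

/-- Half-angle form, from which zeros are read off. -/
theorem chebyshevV_eval_cos (k : ℕ) {φ : ℝ} (hφ : Real.cos φ ≠ 0) :
    (chebyshevV k).eval (Real.cos (2 * φ)) * Real.cos φ = Real.cos ((2 * k + 1) * φ) := by
  have h := congrArg (eval (Real.cos (2 * φ))) (one_add_X_mul_chebyshevV k)
  rw [eval_mul, eval_add, eval_add, eval_one, eval_X, T_real_cos, T_real_cos] at h
  have h1 : Real.cos (((k + 1 : ℕ) : ℤ) * (2 * φ)) + Real.cos ((k : ℤ) * (2 * φ))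
      = 2 * Real.cos ((2 * k + 1) * φ) * Real.cos φ := by
    rw [Real.cos_add_cos]
    push_cast
    congr 3 <;> ring
  rw [h1, Real.cos_two_mul] at h
  rw [Real.cos_two_mul]
  apply mul_left_cancel₀ (mul_ne_zero two_ne_zero hφ)
  linear_combination h

theorem chebyshevV_eval_neg_one (k : ℕ) :
    (chebyshevV k).eval (-1) = (-1) ^ k * (2 * k + 1) := by
  rw [chebyshevV, eval_sub, U_eval_neg_one, U_eval_neg_one, Int.negOnePow_sub]
  simp
  ring

theorem isGreatest_auxValues_odd (m : ℕ) :
    IsGreatest (auxValues (2 * m + 1))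
      (1 / 4 * (1 / Real.sin (Real.pi / (2 * (2 * m + 3)))) ^ 2) := by
  -- The odd multiples of `δ` are zeros of `cos ((2m + 3) φ)`.
  set δ : ℝ := Real.pi / (2 * (2 * m + 3)) with hδ
  have hδpos : 0 < δ := by positivity
  have hδpi : (2 * m + 3) * (2 * δ) = Real.pi := by rw [hδ]; field_simp
  set x : ℕ → ℝ := fun i => Real.cos (2 * ((2 * i + 1) * δ)) with hxdef
  have hang : ∀ i ≤ m, 2 * ((2 * i + 1) * δ) < Real.pi := by
    intro i hi
    have : (i : ℝ) ≤ m := by exact_mod_cast hi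
    nlinarith
  have hanti : ∀ i j : ℕ, i < j → j ≤ m → x j < x i := by
    intro i j hij hj
    have : (i : ℝ) < j := by exact_mod_cast hij
    exact Real.cos_lt_cos_of_nonneg_of_le_pi (by positivity) (hang j hj).le (by gcongr)
  have hinj : Set.InjOn x (Finset.range (m + 1)) := by
    intro i hi j hj hij
    simp only [Finset.coe_range, Set.mem_Iio] at hi hj
    rcases lt_trichotomy i j with h | h | h
    · exact absurd hij (hanti i j h (by omega)).ne'
    · exact h
    · exact absurd hij (hanti j i h (by omega)).ne
  set Z := (Finset.range (m + 1)).image x with hZ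
  have hcard : Z.card = m + 1 := by rw [hZ, Finset.card_image_of_injOn hinj, Finset.card_range]
  have hx0 : x 0 = Real.cos (2 * δ) := by simp [hxdef]
  have hx0Z : x 0 ∈ Z := Finset.mem_image_of_mem x (by simp)
  have hδlt : 2 * δ < Real.pi := by simpa using hang 0 (Nat.zero_le _)
  have hroot : ∀ z ∈ Z, (chebyshevV (m + 1)).eval z = 0 := by
    intro z hz
    obtain ⟨i, hi, rfl⟩ := Finset.mem_image.mp hz
    have him := hang i (Nat.lt_succ_iff.mp (Finset.mem_range.mp hi))
    have hcos : 0 < Real.cos ((2 * i + 1) * δ) :=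
      Real.cos_pos_of_mem_Ioo ⟨by linarith [Real.pi_pos, show 0 ≤ (2 * i + 1) * δ by positivity],
        by linarith⟩
    have h := chebyshevV_eval_cos (m + 1) hcos.ne'
    rw [show (2 * ((m + 1 : ℕ) : ℝ) + 1) * ((2 * i + 1) * δ) = i * Real.pi + Real.pi / 2 by
      rw [← hδpi]; push_cast; ring, Real.cos_add_pi_div_two, Real.sin_nat_mul_pi, neg_zero] at h
    exact (mul_eq_zero.mp h).resolve_right hcos.ne'
  rw [← one_div_two_mul_one_sub_cos, ← hx0]
  refine isGreatest_auxValues_of_nodes (d := m + 1) (P := Lagrange.nodal (Z.erase (x 0)) id ^ 2)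
    (by omega) hx0Z ?_ ?_ ⟨?_, ?_⟩
    (annihilates_nodal weightedMean ((degree_chebyshevV _).trans (by rw [hcard])) hroot
      fun r hr => weightedMean_chebyshevV_mul hr) (by omega) (by omega) ?_ ?_ ?_ ?_
  · intro z hz
    obtain ⟨i, hi, rfl⟩ := Finset.mem_image.mp hz
    rcases Nat.eq_zero_or_pos i with rfl | h
    · exact le_rfl
    · exact (hanti 0 i h (Nat.lt_succ_iff.mp (Finset.mem_range.mp hi))).le
  · intro z hz
    obtain ⟨i, -, rfl⟩ := Finset.mem_image.mp hz
    exact Real.neg_one_le_cos _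
  · rw [hx0, ← Real.cos_pi]
    exact Real.cos_lt_cos_of_nonneg_of_le_pi (by positivity) le_rfl hδlt
  · rw [hx0, ← Real.cos_zero]
    exact Real.cos_lt_cos_of_nonneg_of_le_pi le_rfl hδlt.le (by positivity)
  · rw [degree_pow, Lagrange.degree_nodal, Finset.card_erase_of_mem hx0Z, hcard, nsmul_eq_mul]
    norm_cast
    omega
  · intro y _
    rw [eval_pow]
    positivity
  · intro z hz hzx
    rw [eval_pow, show eval z (Lagrange.nodal (Z.erase (x 0)) id) = 0 from
      Lagrange.eval_nodal_at_node (v := id) (Finset.mem_erase.mpr ⟨hzx, hz⟩)]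
    simp
  · rw [eval_pow]
    have := Lagrange.eval_nodal_not_at_node (s := Z.erase (x 0)) (v := id) (x := x 0)
      fun z hz => (Finset.ne_of_mem_erase hz).symm
    positivity

/-! ### Even `N`: the Gauss–Radau rule. -/

/-- At multiples of `π / M` the sine term vanishes, so for `M > 0` the sign is that of `cos (Mθ) cos
θ`. -/
theorem cos_combination_eq (M θ : ℝ) :
    (M + 1) * Real.cos ((M - 1) * θ) + (M - 1) * Real.cos ((M + 1) * θ)
      = 2 * M * Real.cos (M * θ) * Real.cos θ + 2 * Real.sin (M * θ) * Real.sin θ := by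
  rw [sub_mul, add_mul M 1 θ, one_mul, Real.cos_sub, Real.cos_add]
  ring

/-- The left-hand side of the equation defining `posRoots` changes sign on each interval
`(iπ/M, (i+1)π/M)`, `M = N + 2`, to the left of `π/2`. -/
theorem exists_root_cos_combination {M : ℝ} (hM : 0 < M) {i : ℕ} (hi : (i + 1) * 2 < M) :
    ∃ φ ∈ Set.Ioo (i * Real.pi / M) ((i + 1) * Real.pi / M),
      (M + 1) * Real.cos ((M - 1) * φ) + (M - 1) * Real.cos ((M + 1) * φ) = 0 := by
  set G : ℝ → ℝ := fun φ =>
    (M + 1) * Real.cos ((M - 1) * φ) + (M - 1) * Real.cos ((M + 1) * φ) with hG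
  have hpi := Real.pi_pos
  have hval : ∀ k : ℕ, (k : ℝ) ≤ i + 1 → ∃ c : ℝ, 0 < c ∧ G (k * Real.pi / M) = (-1) ^ k * c := by
    intro k hk
    refine ⟨2 * M * Real.cos (k * Real.pi / M), ?_, ?_⟩
    · refine mul_pos (by positivity) (Real.cos_pos_of_mem_Ioo ⟨?_, ?_⟩)
      · have : 0 ≤ k * Real.pi / M := by positivity
        linarith
      · rw [div_lt_iff₀ hM]
        nlinarith
    · simp only [hG]
      rw [cos_combination_eq, mul_div_cancel₀ _ hM.ne', Real.sin_nat_mul_pi, Real.cos_nat_mul_pi]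
      ring
  have hcont : ContinuousOn (fun φ => (-1) ^ i * G φ)
      (Set.Icc (i * Real.pi / M) ((i + 1) * Real.pi / M)) :=
    Continuous.continuousOn (by fun_prop)
  obtain ⟨a, ha, haG⟩ := hval i (by linarith)
  obtain ⟨b, hb, hbG⟩ := hval (i + 1) (by push_cast; exact le_rfl)
  have hsq : ((-1 : ℝ) ^ i) * (-1) ^ i = 1 := by rw [← mul_pow]; simp
  push_cast at hbG
  have hmem : (0 : ℝ) ∈ Set.Ioo ((-1) ^ i * G ((i + 1) * Real.pi / M))
      ((-1) ^ i * G (i * Real.pi / M)) := by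
    rw [haG, hbG, pow_succ]
    constructor
    · linear_combination hb - b * hsq
    · linear_combination ha - a * hsq
  obtain ⟨φ, hφ, h0⟩ := intermediate_value_Ioo' (by gcongr; linarith) hcont hmem
  exact ⟨φ, hφ, (mul_eq_zero.mp h0).resolve_left (by positivity)⟩

theorem mem_posRoots_iff {N : ℕ} {M θ : ℝ} (hM : M = N + 2) :
    θ ∈ posRoots N ↔
      0 < θ ∧ (M + 1) * Real.cos ((M - 1) * θ) + (M - 1) * Real.cos ((M + 1) * θ) = 0 := by
  rw [posRoots, Set.mem_ofPred_eq, hM, show (N : ℝ) + 2 + 1 = N + 3 by ring,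
    show (N : ℝ) + 2 - 1 = N + 1 by ring]

theorem exists_isLeast_posRoots {N : ℕ} {φ : ℝ} (hφ : φ ∈ posRoots N) :
    ∃ θ, IsLeast (posRoots N) θ := by
  have hcl : IsCompact (Set.Icc 0 φ ∩ {θ : ℝ | ((N : ℝ) + 3) * Real.cos (((N : ℝ) + 1) * θ)
      + ((N : ℝ) + 1) * Real.cos (((N : ℝ) + 3) * θ) = 0}) :=
    isCompact_Icc.inter_right (isClosed_eq (by fun_prop) continuous_const)
  obtain ⟨θ, hθ, hmin⟩ := hcl.exists_isLeast ⟨φ, ⟨hφ.1.le, le_rfl⟩, hφ.2⟩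
  refine ⟨θ, ⟨hθ.1.1.lt_of_ne ?_, hθ.2⟩, fun ψ hψ => ?_⟩
  -- At `0` the left-hand side equals `2N + 4`, so `0` is not a root.
  · rintro rfl
    have h := hθ.2
    simp only [Set.mem_ofPred_eq, mul_zero, Real.cos_zero, mul_one] at h
    have : (0 : ℝ) ≤ N := N.cast_nonneg
    linarith
  · rcases le_total ψ φ with h | h
    · exact hmin ⟨⟨hψ.1.le, h⟩, hψ.2⟩
    · exact hθ.1.2.trans h

/-- The nodal polynomial of the quadrature rule with a prescribed node at `-1`. -/
noncomputable def radauPoly (m : ℕ) : ℝ[X] :=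
  C (2 * m + 5 : ℝ) * chebyshevV (m + 1) + C (2 * m + 3 : ℝ) * chebyshevV (m + 2)

theorem degree_radauPoly (m : ℕ) : (radauPoly m).degree = (m + 2 : ℕ) := by
  have h5 : (2 * m + 5 : ℝ) ≠ 0 := by positivity
  have h3 : (2 * m + 3 : ℝ) ≠ 0 := by positivity
  rw [radauPoly, degree_add_eq_right_of_degree_lt] <;>
    rw [degree_C_mul h3, degree_chebyshevV]
  rw [degree_C_mul h5, degree_chebyshevV]
  norm_cast
  omega

theorem weightedMean_radauPoly_mul {m : ℕ} {r : ℝ[X]} (hr : r.degree < (m + 1 : ℕ)) :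
    weightedMean (radauPoly m * r) = 0 := by
  rw [radauPoly, add_mul, mul_assoc, mul_assoc, ← smul_eq_C_mul, ← smul_eq_C_mul, map_add,
    map_smul, map_smul, weightedMean_chebyshevV_mul hr,
    weightedMean_chebyshevV_mul (hr.trans (by norm_cast; omega))]
  simp

/-- The coefficients are the values `|V_k(-1)| = 2k + 1`, swapped so that the alternating signs
cancel. -/
theorem radauPoly_eval_neg_one (m : ℕ) : (radauPoly m).eval (-1) = 0 := by
  simp only [radauPoly, eval_add, eval_mul, eval_C, chebyshevV_eval_neg_one]
  push_cast
  ring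

theorem radauPoly_eval_cos (m : ℕ) {φ : ℝ} (hφ : Real.cos φ ≠ 0) :
    (radauPoly m).eval (Real.cos (2 * φ)) * Real.cos φ
      = (2 * m + 5) * Real.cos ((2 * m + 3) * φ) + (2 * m + 3) * Real.cos ((2 * m + 5) * φ) := by
  have h1 := chebyshevV_eval_cos (m + 1) hφ
  have h2 := chebyshevV_eval_cos (m + 2) hφ
  rw [show 2 * ((m + 1 : ℕ) : ℝ) + 1 = 2 * m + 3 by push_cast; ring] at h1
  rw [show 2 * ((m + 2 : ℕ) : ℝ) + 1 = 2 * m + 5 by push_cast; ring] at h2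
  rw [radauPoly, eval_add, eval_mul, eval_mul, eval_C, eval_C, ← h1, ← h2]
  ring

theorem isGreatest_auxValues_even (m : ℕ) :
    ∃ θ : ℝ, IsLeast (posRoots (2 * m + 2)) θ ∧
      IsGreatest (auxValues (2 * m + 2)) (1 / 4 * (1 / Real.sin θ) ^ 2) := by
  set M : ℝ := 2 * m + 4 with hMdef
  have hM : 0 < M := by positivity
  have hMN : M = ((2 * m + 2 : ℕ) : ℝ) + 2 := by rw [hMdef]; push_cast; ring
  have hpi := Real.pi_pos
  have hex : ∀ i : ℕ, i ≤ m → ∃ φ ∈ Set.Ioo (i * Real.pi / M) ((i + 1) * Real.pi / M),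
      φ ∈ posRoots (2 * m + 2) := by
    intro i hi
    have : (i : ℝ) ≤ m := by exact_mod_cast hi
    obtain ⟨φ, hφ, h⟩ := exists_root_cos_combination hM (i := i) (by rw [hMdef]; linarith)
    exact ⟨φ, hφ, (mem_posRoots_iff hMN).mpr
      ⟨(show 0 ≤ i * Real.pi / M by positivity).trans_lt hφ.1, h⟩⟩
  obtain ⟨φ₀, hφ₀, hroot₀⟩ := hex 0 (Nat.zero_le _)
  obtain ⟨θ, hθ⟩ := exists_isLeast_posRoots hroot₀
  refine ⟨θ, hθ, ?_⟩
  -- Taking the least root `θ` itself in the first interval avoids proving uniqueness of the root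
  -- there.
  have hex' : ∀ i : ℕ, ∃ φ, i ≤ m → φ ∈ Set.Ioo (i * Real.pi / M) ((i + 1) * Real.pi / M) ∧
      φ ∈ posRoots (2 * m + 2) ∧ (i = 0 → φ = θ) := by
    intro i
    by_cases hi : i ≤ m
    · rcases Nat.eq_zero_or_pos i with rfl | hi0
      · refine ⟨θ, fun _ => ⟨⟨?_, (hθ.2 hroot₀).trans_lt hφ₀.2⟩, hθ.1, fun _ => rfl⟩⟩
        simpa using hθ.1.1
      · obtain ⟨φ, h1, h2⟩ := hex i hi
        exact ⟨φ, fun _ => ⟨h1, h2, fun h => absurd h hi0.ne'⟩⟩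
    · exact ⟨0, fun h => absurd h hi⟩
  choose φ hφ using hex'
  have hφ0 : φ 0 = θ := (hφ 0 (Nat.zero_le _)).2.2 rfl
  have hlt : ∀ i ≤ m, 2 * φ i < Real.pi := by
    intro i hi
    have h1 := (hφ i hi).1.2
    have : (i : ℝ) ≤ m := by exact_mod_cast hi
    have h2 : (i + 1) * Real.pi / M ≤ Real.pi / 2 := by
      rw [div_le_div_iff₀ hM two_pos]
      nlinarith
    linarith
  set x : ℕ → ℝ := fun i => Real.cos (2 * φ i) with hxdef
  have hanti : ∀ i j : ℕ, i < j → j ≤ m → x j < x i := by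
    intro i j hij hj
    have h1 := (hφ i (by omega)).1.2
    have h2 := (hφ j hj).1.1
    have h3 : ((i : ℝ) + 1) * Real.pi / M ≤ j * Real.pi / M := by
      gcongr
      exact_mod_cast hij
    exact Real.cos_lt_cos_of_nonneg_of_le_pi (by linarith [(hφ i (by omega)).2.1.1])
      (hlt j hj).le (by linarith)
  have hinj : Set.InjOn x (Finset.range (m + 1)) := by
    intro i hi j hj hij
    simp only [Finset.coe_range, Set.mem_Iio] at hi hj
    rcases lt_trichotomy i j with h | h | h
    · exact absurd hij (hanti i j h (by omega)).ne'
    · exact h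
    · exact absurd hij (hanti j i h (by omega)).ne
  have hgt : ∀ i ≤ m, -1 < x i := by
    intro i hi
    rw [← Real.cos_pi]
    exact Real.cos_lt_cos_of_nonneg_of_le_pi (by linarith [(hφ i hi).2.1.1]) le_rfl (hlt i hi)
  set Y := (Finset.range (m + 1)).image x with hY
  have hmemY : ∀ z ∈ Y, ∃ i ≤ m, x i = z := by
    intro z hz
    obtain ⟨i, hi, rfl⟩ := Finset.mem_image.mp hz
    exact ⟨i, Nat.lt_succ_iff.mp (Finset.mem_range.mp hi), rfl⟩
  have hcardY : Y.card = m + 1 := by rw [hY, Finset.card_image_of_injOn hinj, Finset.card_range]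
  have hnotMem : (-1 : ℝ) ∉ Y := by
    intro h
    obtain ⟨i, hi, hxi⟩ := hmemY _ h
    exact (hgt i hi).ne' hxi
  have hcard : (insert (-1) Y).card = m + 2 := by rw [Finset.card_insert_of_notMem hnotMem, hcardY]
  have hx0Y : x 0 ∈ Y := Finset.mem_image_of_mem x (by simp)
  have hroot : ∀ z ∈ insert (-1) Y, (radauPoly m).eval z = 0 := by
    intro z hz
    rcases Finset.mem_insert.mp hz with rfl | hz
    · exact radauPoly_eval_neg_one m
    obtain ⟨i, hi, rfl⟩ := hmemY z hz
    have hpos := (hφ i hi).2.1.1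
    have hcos : 0 < Real.cos (φ i) :=
      Real.cos_pos_of_mem_Ioo ⟨by linarith, by linarith [hlt i hi]⟩
    have h := radauPoly_eval_cos m hcos.ne'
    have h0 := ((mem_posRoots_iff hMN).mp (hφ i hi).2.1).2
    rw [show M + 1 = 2 * m + 5 by rw [hMdef]; ring,
      show M - 1 = 2 * m + 3 by rw [hMdef]; ring] at h0
    rw [h0] at h
    exact (mul_eq_zero.mp h).resolve_right hcos.ne'
  rw [← one_div_two_mul_one_sub_cos, ← hφ0]
  -- The factor `1 + X` kills the node `-1` without breaking nonnegativity; the degree is `2m + 1 =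
  -- N - 1`.
  refine isGreatest_auxValues_of_nodes (d := m + 1)
    (P := (1 + X) * Lagrange.nodal (Y.erase (x 0)) id ^ 2)
    (by omega) (Finset.mem_insert_of_mem hx0Y) ?_ ?_ ⟨hgt 0 (Nat.zero_le _), ?_⟩
    (annihilates_nodal weightedMean ((degree_radauPoly _).trans (by rw [hcard])) hroot
      fun r hr => weightedMean_radauPoly_mul hr) (by omega) (by omega) ?_ ?_ ?_ ?_
  · intro z hz
    rcases Finset.mem_insert.mp hz with rfl | hz
    · exact (hgt 0 (Nat.zero_le _)).le
    obtain ⟨i, hi, rfl⟩ := hmemY z hz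
    rcases Nat.eq_zero_or_pos i with rfl | h
    · exact le_rfl
    · exact (hanti 0 i h hi).le
  · intro z hz
    rcases Finset.mem_insert.mp hz with rfl | hz
    · exact le_rfl
    obtain ⟨i, hi, rfl⟩ := hmemY z hz
    exact (hgt i hi).le
  · rw [← Real.cos_zero]
    exact Real.cos_lt_cos_of_nonneg_of_le_pi le_rfl (hlt 0 (Nat.zero_le _)).le
      (by linarith [(hφ 0 (Nat.zero_le _)).2.1.1])
  · rw [degree_mul, degree_pow, Lagrange.degree_nodal, Finset.card_erase_of_mem hx0Y, hcardY,
      nsmul_eq_mul, add_comm (1 : ℝ[X]) X, show (X + 1 : ℝ[X]) = X + C 1 by simp, degree_X_add_C]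
    norm_cast
    omega
  · intro y hy
    rw [eval_mul, eval_pow, eval_add, eval_one, eval_X]
    exact mul_nonneg (by linarith [hy.1]) (sq_nonneg _)
  · intro z hz hzx
    rcases Finset.mem_insert.mp hz with rfl | hz
    · simp
    rw [eval_mul, eval_pow, show eval z (Lagrange.nodal (Y.erase (x 0)) id) = 0 from
      Lagrange.eval_nodal_at_node (v := id) (Finset.mem_erase.mpr ⟨hzx, hz⟩)]
    simp
  · have := Lagrange.eval_nodal_not_at_node (s := Y.erase (x 0)) (v := id) (x := x 0)
      fun z hz => (Finset.ne_of_mem_erase hz).symm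
    rw [eval_mul, eval_pow, eval_add, eval_one, eval_X]
    exact mul_pos (by linarith [hgt 0 (Nat.zero_le _)]) (by positivity)

theorem theorem3p1 (N : ℕ) (hN : 1 ≤ N) :
    (Odd N →
      IsGreatest (auxValues N) (1 / 4 * (1 / Real.sin (Real.pi / (2 * ((N : ℝ) + 2)))) ^ 2)) ∧
    (Even N →
      ∃ θ : ℝ, IsLeast (posRoots N) θ ∧
        IsGreatest (auxValues N) (1 / 4 * (1 / Real.sin θ) ^ 2)) := by
  constructor
  · rintro ⟨m, rfl⟩
    have h := isGreatest_auxValues_odd m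
    rwa [show (2 * (m : ℝ) + 3) = ((2 * m + 1 : ℕ) : ℝ) + 2 by push_cast; ring] at h
  · rintro ⟨k, rfl⟩
    obtain ⟨m, rfl⟩ : ∃ m, k = m + 1 := ⟨k - 1, by omega⟩
    rw [show m + 1 + (m + 1) = 2 * m + 2 by ring]
    exact isGreatest_auxValues_even m
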